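/- For an open set $G\subset\mathbb{C}$ let $H(G)$ denote the space of holomorphic functions on $G$ with the topology of uniform convergence on compact subsets of $G$, and for $n\in\mathbb{N}$ let $\widetilde{T}_n:H(G)\to H(G)$ be the continuous linear operator $$\widetilde{T}_n(f)(\zeta)=\sum_{j=0}^{n}\frac{f^{(j)}(\zeta)}{j!}(-\zeta)^j,\qquad \zeta\in G.$$ Let $G\subset\mathbb{C}$ be a simply connected domain with $0\notin G$, and let $(\lambda^{(1)}_n)_n$ and $(\lambda^{(2)}_n)_n$ be two sequences of positive integers with $\lim_n\lambda^{(1)}_n=+\infty$ and $\lim_n\lambda^{(2)}_n/\lambda^{(1)}_n=+\infty$. Then the sequence of continuous linear operators $$D_n:H(G)\to H(G)\times H(G),\qquad D_n(f)=\bigl(\widetilde{T}_{\lambda^{(1)}_n}(f),\,\widetilde{T}_{\lambda^{(2)}_n}(f)\bigr),$$ is universal, that is, there exists $f\in H(G)$ such that $\{D_n(f): n\}$ is dense in $H(G)\times H(G)$. In other words, the sequences $(\widetilde{T}_{\lambda^{(1)}_n})_n$ and $(\widetilde{T}_{\lambda^{(2)}_n})_n$ are disjointly universal. -/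

import Mathlib

open Filter Topology TopologicalSpace

noncomputable section

namespace DisjointUniversality

/-- The extension by zero to the whole plane of a function on the open set `G`. As `G` is open,
the (iterated) complex derivatives at points of `G` do not depend on the values outside `G`. -/
def ext {G : Opens ℂ} (f : C(G, ℂ)) : ℂ → ℂ :=
  Function.extend (Subtype.val : G → ℂ) f 0

theorem ext_apply {G : Opens ℂ} (f : C(G, ℂ)) (z : G) : ext f (z : ℂ) = f z :=
  Subtype.val_injective.extend_apply _ _ _

theorem ext_add {G : Opens ℂ} (f g : C(G, ℂ)) : ext (f + g) = ext f + ext g := by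
  funext z
  by_cases hz : z ∈ G
  · lift z to G using hz
    simp [ext_apply]
  · have h : ¬ ∃ a : G, (a : ℂ) = z := by rintro ⟨a, rfl⟩; exact hz a.2
    simp [ext, Function.extend_apply' _ _ _ h]

theorem ext_smul {G : Opens ℂ} (c : ℂ) (f : C(G, ℂ)) : ext (c • f) = c • ext f := by
  funext z
  by_cases hz : z ∈ G
  · lift z to G using hz
    simp [ext_apply]
  · have h : ¬ ∃ a : G, (a : ℂ) = z := by rintro ⟨a, rfl⟩; exact hz a.2
    simp [ext, Function.extend_apply' _ _ _ h]

/-- `H(G)`: the space of holomorphic functions on the open set `G`, as a subspace of `C(G, ℂ)`.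
Its topology is the subspace topology of the compact-open topology of `C(G, ℂ)`, that is, the
topology of uniform convergence on the compact subsets of `G`. -/
def H (G : Opens ℂ) : Submodule ℂ C(G, ℂ) where
  carrier := {f | DifferentiableOn ℂ (ext f) (G : Set ℂ)}
  add_mem' := by
    intro f g hf hg
    simp only [Set.mem_ofPred_eq, ext_add] at *
    exact hf.add hg
  zero_mem' := by
    have h : ext (0 : C(G, ℂ)) = 0 := by
      have h' := ext_smul (G := G) 0 0
      rwa [zero_smul ℂ (0 : C(G, ℂ)), zero_smul ℂ (ext (0 : C(G, ℂ)))] at h'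
    simp only [Set.mem_ofPred_eq, h]
    exact differentiableOn_const 0
  smul_mem' := by
    intro c f hf
    simp only [Set.mem_ofPred_eq, ext_smul] at *
    exact hf.const_smul c

theorem differentiableOn_ext {G : Opens ℂ} (f : H G) :
    DifferentiableOn ℂ (ext (f : C(G, ℂ))) (G : Set ℂ) := f.2

/-- The element of `H(G)` given by the restriction to `G` of a function holomorphic on `G`. -/
def holMk {G : Opens ℂ} (F : ℂ → ℂ) (hF : DifferentiableOn ℂ F (G : Set ℂ)) : H G :=
  ⟨⟨fun z => F z, hF.continuousOn.domRestrict⟩,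
    hF.congr fun z hz => ext_apply (G := G) ⟨fun z => F z, hF.continuousOn.domRestrict⟩ ⟨z, hz⟩⟩

theorem holMk_apply {G : Opens ℂ} (F : ℂ → ℂ) (hF : DifferentiableOn ℂ F (G : Set ℂ)) (z : G) :
    (holMk F hF : C(G, ℂ)) z = F z := rfl

theorem differentiableOn_iteratedDeriv {G : Opens ℂ} (f : H G) (j : ℕ) :
    DifferentiableOn ℂ (iteratedDeriv j (ext (f : C(G, ℂ)))) (G : Set ℂ) := by
  induction j with
  | zero => simpa using (differentiableOn_ext f)
  | succ j ih => rw [iteratedDeriv_succ]; exact ih.deriv G.isOpen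

theorem contDiffAt_ext {G : Opens ℂ} (f : H G) (j : ℕ) (z : G) :
    ContDiffAt ℂ j (ext (f : C(G, ℂ))) (z : ℂ) :=
  ((differentiableOn_ext f).contDiffOn G.isOpen).contDiffAt (G.isOpen.mem_nhds z.2)

/-- `f ↦ ∑_{j ≤ n} f^{(j)}(ζ) / j! (-ζ)^j` as a map of `H(G)` into itself. -/
def taylorFun (G : Opens ℂ) (n : ℕ) (f : H G) : H G :=
  holMk (fun ζ => ∑ j ∈ Finset.range (n + 1),
      iteratedDeriv j (ext (f : C(G, ℂ))) ζ / (j.factorial : ℂ) * (-ζ) ^ j)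
    (DifferentiableOn.fun_sum fun j _ =>
      ((differentiableOn_iteratedDeriv f j).div_const _).mul
        (differentiableOn_id.neg.pow j))

theorem taylorFun_apply (G : Opens ℂ) (n : ℕ) (f : H G) (ζ : G) :
    (taylorFun G n f : C(G, ℂ)) ζ = ∑ j ∈ Finset.range (n + 1),
      iteratedDeriv j (ext (f : C(G, ℂ))) ζ / (j.factorial : ℂ) * (-(ζ : ℂ)) ^ j := rfl

theorem tendstoLocallyUniformlyOn_ext {G : Opens ℂ} {ι : Type*} {l : Filter ι} {F : ι → C(G, ℂ)}
    {f : C(G, ℂ)} : Tendsto F l (𝓝 f) ↔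
      TendstoLocallyUniformlyOn (fun i => ext (F i)) (ext f) l (G : Set ℂ) := by
  have : LocallyCompactSpace G := G.isOpen.isOpenEmbedding_subtypeVal.locallyCompactSpace
  rw [ContinuousMap.tendsto_iff_tendstoLocallyUniformly,
    tendstoLocallyUniformlyOn_iff_tendstoLocallyUniformly_comp_coe]
  have h1 : ∀ g : C(G, ℂ), ext g ∘ (Subtype.val : G → ℂ) = fun z => g z := fun g =>
    funext fun z => ext_apply g z
  have h2 : (fun i (z : G) => ext (F i) z) = fun i z => F i z := funext fun i => h1 (F i)
  change _ ↔ TendstoLocallyUniformly (fun i (z : G) => ext (F i) z) (ext f ∘ Subtype.val) l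
  rw [h1, h2]

theorem tendstoLocallyUniformlyOn_iteratedDeriv {G : Opens ℂ} (f : H G) (j : ℕ) :
    TendstoLocallyUniformlyOn (fun g : H G => iteratedDeriv j (ext (g : C(G, ℂ))))
      (iteratedDeriv j (ext (f : C(G, ℂ)))) (𝓝 f) (G : Set ℂ) := by
  induction j with
  | zero =>
    simpa using tendstoLocallyUniformlyOn_ext.1 (continuous_subtype_val.tendsto f)
  | succ j ih =>
    simp only [iteratedDeriv_succ]
    exact ih.deriv (Eventually.of_forall fun g => differentiableOn_iteratedDeriv g j) G.isOpen

theorem continuous_iteratedDeriv (G : Opens ℂ) (j : ℕ) :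
    Continuous fun f : H G =>
      ((holMk _ (differentiableOn_iteratedDeriv f j) : H G) : C(G, ℂ)) := by
  rw [continuous_iff_continuousAt]
  intro f
  refine tendstoLocallyUniformlyOn_ext.2 ?_
  refine ((tendstoLocallyUniformlyOn_iteratedDeriv f j).congr_right ?_).congr ?_
  · intro z hz
    exact (ext_apply (holMk _ (differentiableOn_iteratedDeriv f j)).1 ⟨z, hz⟩).symm
  · intro g z hz
    exact (ext_apply (holMk _ (differentiableOn_iteratedDeriv g j)).1 ⟨z, hz⟩).symm

theorem continuous_taylorFun (G : Opens ℂ) (n : ℕ) : Continuous (taylorFun G n) := by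
  have : LocallyCompactSpace G := G.isOpen.isOpenEmbedding_subtypeVal.locallyCompactSpace
  refine continuous_induced_rng.2 ?_
  have h : (Subtype.val ∘ taylorFun G n) = fun f : H G => ∑ j ∈ Finset.range (n + 1),
      ((holMk _ (differentiableOn_iteratedDeriv f j) : H G) : C(G, ℂ)) *
        (⟨fun z : G => (-(z : ℂ)) ^ j / (j.factorial : ℂ), by fun_prop⟩ : C(G, ℂ)) := by
    funext f
    ext z
    simp only [Function.comp_apply, ContinuousMap.sum_apply, ContinuousMap.mul_apply,
      taylorFun_apply]
    refine Finset.sum_congr rfl fun j _ => ?_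
    simp only [holMk_apply, ContinuousMap.coe_mk]
    ring
  rw [h]
  exact continuous_finsetSum _ fun j _ => (continuous_iteratedDeriv G j).mul continuous_const

/-- The continuous linear operator `T̃_n : H(G) → H(G)`,
`T̃_n f (ζ) = ∑_{j ≤ n} f^{(j)}(ζ) / j! (-ζ)^j`. -/
def taylorOp (G : Opens ℂ) (n : ℕ) : H G →L[ℂ] H G where
  toFun := taylorFun G n
  map_add' := by
    intro f g
    refine Subtype.ext (ContinuousMap.ext fun z => ?_)
    simp only [Submodule.coe_add, ContinuousMap.add_apply, taylorFun_apply]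
    rw [← Finset.sum_add_distrib]
    refine Finset.sum_congr rfl fun j _ => ?_
    rw [ext_add, iteratedDeriv_add (contDiffAt_ext f j z) (contDiffAt_ext g j z)]
    ring
  map_smul' := by
    intro c f
    refine Subtype.ext (ContinuousMap.ext fun z => ?_)
    simp only [Submodule.coe_smul, ContinuousMap.smul_apply, taylorFun_apply, smul_eq_mul,
      RingHom.id_apply]
    rw [Finset.mul_sum]
    refine Finset.sum_congr rfl fun j _ => ?_
    rw [ext_smul, iteratedDeriv_const_smul (contDiffAt_ext f j z) c, smul_eq_mul]
    ring
  cont := continuous_taylorFun G n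

theorem taylorOp_apply (G : Opens ℂ) (n : ℕ) (f : H G) (ζ : G) :
    (taylorOp G n f : C(G, ℂ)) ζ = ∑ j ∈ Finset.range (n + 1),
      iteratedDeriv j (ext (f : C(G, ℂ))) ζ / (j.factorial : ℂ) * (-(ζ : ℂ)) ^ j := rfl

/-- A sequence of continuous linear operators `T n : X → Y` is universal if some vector `x` has a
dense orbit `{T n x : n}` in `Y`. -/
def IsUniversal {X Y : Type*} [AddCommMonoid X] [Module ℂ X] [TopologicalSpace X]
    [AddCommMonoid Y] [Module ℂ Y] [TopologicalSpace Y] (T : ℕ → X →L[ℂ] Y) : Prop :=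
  ∃ x : X, Dense (Set.range fun n => T n x)

/-- Two sequences of continuous linear operators `T n, S n : X → Y` are disjointly universal if for
some vector `x` the set `{(T n x, S n x) : n}` is dense in `Y × Y`. -/
def IsDisjointlyUniversal {X Y : Type*} [AddCommMonoid X] [Module ℂ X] [TopologicalSpace X]
    [AddCommMonoid Y] [Module ℂ Y] [TopologicalSpace Y] (T S : ℕ → X →L[ℂ] Y) : Prop :=
  ∃ x : X, Dense (Set.range fun n => (T n x, S n x))

end DisjointUniversality

end

open Filter Topology TopologicalSpace

noncomputable section

/-! Write `T̃_n` for `taylorOp G n` and `λ₁, λ₂` for `l₁, l₂`. The lower limit of the graphs of the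
`D_n` (`graphLimit`) is a closed linear subspace of `H(G) × H(G) × H(G)`; if it is everything,
Baire's theorem yields a dense orbit (`isUniversal_of_graphLimit_eq_top`). So each of the three
coordinates need only be tested on a family with dense span.

Coordinate 1: `T̃_n p(ζ)` is the Taylor polynomial of `p` at `ζ` evaluated at `0`, so `T̃_n` kills
polynomials with `p(0) = 0` once `n ≥ deg p`; these are dense by Runge's theorem.

Coordinate 3: `z^(-k)` is an eigenvector of `T̃_n` with eigenvalue `eigen k n = C(n+k, k) ≥ n+1`.
Dividing `z^(-k)` by `eigen k λ₂` gives a null sequence that `T̃_{λ₂}` sends to `z^(-k)`, and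
`T̃_{λ₁}` to a null sequence because `λ₂/λ₁ → ∞`.

Coordinate 2: replace `z^(-k)` by a polynomial `q` with `q(0) = 0` and `deg q ≤ λ₂`, so that
`T̃_{λ₂} q = 0`. Cauchy's estimate for `T̃_{λ₁}` loses a factor `A^λ₁`; since `λ₂/λ₁ → ∞`, the
degree of `q` can be a large multiple of `λ₁`, and the geometric rate of approximation
(`exists_polynomial_approx_zpow`) beats this loss.

Negative powers span a dense subspace by Runge's theorem in the variable `1/z`. Runge's theorem
itself follows from the Cauchy-Pompeiu formula with values in the closed subalgebra of `C(K)`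
generated by `z`. -/

namespace DisjointUniversality

/-! ### Cauchy-Pompeiu formula. -/

section

open MeasureTheory

/-- Twice the Wirtinger derivative `∂/∂z̄`. -/
def dbar (ψ : ℂ → ℂ) (w : ℂ) : ℂ := fderiv ℝ ψ w 1 + Complex.I * fderiv ℝ ψ w Complex.I

theorem dbar_eq_zero {ψ : ℂ → ℂ} {w : ℂ} (h : DifferentiableAt ℂ ψ w) : dbar ψ w = 0 := by
  have h1 : fderiv ℝ ψ w = (fderiv ℂ ψ w).restrictScalars ℝ :=
    (h.hasFDerivAt.restrictScalars ℝ).fderiv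
  have h2 : fderiv ℂ ψ w Complex.I = Complex.I * fderiv ℂ ψ w 1 := by
    rw [← smul_eq_mul, ← map_smul, smul_eq_mul, mul_one]
  simp only [dbar, h1, ContinuousLinearMap.coe_restrictScalars', h2]
  rw [← mul_assoc, Complex.I_mul_I]
  ring

theorem continuous_dbar {ψ : ℂ → ℂ} (h : ContDiff ℝ 1 ψ) : Continuous (dbar ψ) := by
  have := h.continuous_fderiv one_ne_zero
  unfold dbar
  fun_prop

theorem dbar_eq_zero_of_notMem_tsupport {ψ : ℂ → ℂ} {w : ℂ} (h : w ∉ tsupport ψ) :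
    dbar ψ w = 0 := by
  have : fderiv ℝ ψ w = 0 := by
    by_contra h'
    exact h (support_fderiv_subset ℝ h')
  simp [dbar, this]

/-- The polar form of `∂/∂z̄`: removing the phase leaves the radial derivative plus `i` times the
tangential one. -/
theorem mul_dbar_eq (ψ : ℂ → ℂ) (w : ℂ) (θ : ℝ) :
    dbar ψ w * (Real.cos θ + Real.sin θ * Complex.I)⁻¹ =
      fderiv ℝ ψ w (Real.cos θ + Real.sin θ * Complex.I) +
        Complex.I * fderiv ℝ ψ w (Complex.I * (Real.cos θ + Real.sin θ * Complex.I)) := by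
  have h1 : (Real.cos θ + Real.sin θ * Complex.I : ℂ) =
      Real.cos θ • (1 : ℂ) + Real.sin θ • Complex.I := by simp
  have h2 : Complex.I * (Real.cos θ + Real.sin θ * Complex.I : ℂ) =
      Real.cos θ • Complex.I + (-Real.sin θ) • (1 : ℂ) := by
    simp only [Complex.real_smul, Complex.ofReal_neg]
    linear_combination (Real.sin θ : ℂ) * Complex.I_mul_I
  have h4 : (Real.cos θ + Real.sin θ * Complex.I : ℂ) *
      (Real.cos θ - Real.sin θ * Complex.I) = 1 := by
    have := Complex.cos_sq_add_sin_sq (θ : ℂ)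
    push_cast
    linear_combination this - (Complex.sin θ) ^ 2 * Complex.I_mul_I
  have h3 : (Real.cos θ + Real.sin θ * Complex.I : ℂ)⁻¹ =
      Real.cos θ - Real.sin θ * Complex.I := inv_eq_of_mul_eq_one_right h4
  rw [h3, h2, h1]
  simp only [map_add, map_smul, dbar]
  simp only [Complex.real_smul, Complex.ofReal_neg]
  linear_combination (-(Real.sin θ : ℂ) * fderiv ℝ ψ w Complex.I) * Complex.I_mul_I

/-- In polar coordinates the Jacobian cancels `|w|⁻¹`. The radial part `A` integrates to `-φ 0`
along each ray; the tangential part `B` integrates to `0` over each circle by periodicity. -/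
theorem integral_dbar_mul_inv {φ : ℂ → ℂ} (hφ : ContDiff ℝ 1 φ) (hc : HasCompactSupport φ) :
    ∫ w, dbar φ w * w⁻¹ = -(2 * Real.pi) * φ 0 := by
  obtain ⟨R, hR⟩ : ∃ R : ℝ, ∀ w, R < ‖w‖ → w ∉ tsupport φ := by
    obtain ⟨R, hR⟩ := hc.isBounded.exists_norm_le
    exact ⟨R, fun w hw h => absurd (hR w h) (not_le.2 hw)⟩
  have hzero : ∀ w, R < ‖w‖ → fderiv ℝ φ w = 0 := fun w hw => by
    by_contra h'
    exact hR w hw (support_fderiv_subset ℝ h')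
  have hcont := hφ.continuous_fderiv one_ne_zero
  have hdiff : Differentiable ℝ φ := hφ.differentiable one_ne_zero
  set e : ℝ → ℂ := fun θ => Real.cos θ + Real.sin θ * Complex.I with he
  have hec : Continuous e := by fun_prop
  have hen : ∀ θ, ‖e θ‖ = 1 := fun θ => by
    have := Complex.norm_exp_ofReal_mul_I θ
    rwa [Complex.exp_mul_I, ← Complex.ofReal_cos, ← Complex.ofReal_sin] at this
  have hed : ∀ θ, HasDerivAt e (Complex.I * e θ) θ := fun θ => by
    have h1 := (Real.hasDerivAt_cos θ).ofReal_comp.add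
      ((Real.hasDerivAt_sin θ).ofReal_comp.mul_const Complex.I)
    refine h1.congr_deriv ?_
    simp only [he, Complex.ofReal_neg]
    linear_combination -(Real.sin θ : ℂ) * Complex.I_mul_I
  let A : ℝ × ℝ → ℂ := fun p => fderiv ℝ φ (p.1 * e p.2) (e p.2)
  let B : ℝ × ℝ → ℂ := fun p => fderiv ℝ φ (p.1 * e p.2) (Complex.I * e p.2)
  have hint : ∀ F : ℝ × ℝ → ℂ, Continuous F → (∀ p : ℝ × ℝ, R < p.1 → F p = 0) →
      IntegrableOn F (Set.Ioi (0 : ℝ) ×ˢ Set.Ioo (-Real.pi) Real.pi) := by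
    intro F hF h0
    have h1 : IntegrableOn F (Set.Icc 0 R ×ˢ Set.Icc (-Real.pi) Real.pi) :=
      hF.continuousOn.integrableOn_compact (isCompact_Icc.prod isCompact_Icc)
    refine h1.of_forall_sdiff_eq_zero (measurableSet_Ioi.prod measurableSet_Ioo) ?_
    rintro ⟨r, θ⟩ ⟨⟨h2, h3⟩, h4⟩
    refine h0 _ (not_le.1 fun h5 => h4 ⟨⟨le_of_lt h2, h5⟩, h3.1.le, h3.2.le⟩)
  have habs : ∀ p : ℝ × ℝ, R < p.1 → R < ‖(p.1 : ℂ) * e p.2‖ := fun p hp => by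
    rw [norm_mul, hen, mul_one, Complex.norm_real, Real.norm_eq_abs]
    exact hp.trans_le (le_abs_self _)
  have hAi := hint A (by fun_prop) fun p hp => by simp [A, hzero _ (habs p hp)]
  have hBi := hint B (by fun_prop) fun p hp => by simp [B, hzero _ (habs p hp)]
  have hA : ∫ p in Set.Ioi (0 : ℝ) ×ˢ Set.Ioo (-Real.pi) Real.pi, A p =
      -(2 * Real.pi) * φ 0 := by
    rw [Measure.volume_eq_prod, ← setIntegral_prod_swap, setIntegral_prod]
    · have : ∀ θ : ℝ, ∫ r in Set.Ioi (0 : ℝ), A (θ, r).swap = -φ 0 := fun θ => by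
        have h1 : ∀ r : ℝ, HasDerivAt (fun r : ℝ => φ (r * e θ)) (A (r, θ)) r := fun r => by
          have h2 : HasDerivAt (fun r : ℝ => (r : ℂ) * e θ) (e θ) r := by
            simpa using (Complex.ofRealCLM.hasDerivAt (x := r)).mul_const (e θ)
          exact (hdiff _).hasFDerivAt.comp_hasDerivAt r h2
        have h3 : ContDiff ℝ 1 fun r : ℝ => φ (r * e θ) :=
          hφ.comp (Complex.ofRealCLM.contDiff.mul contDiff_const)
        have h4 : HasCompactSupport fun r : ℝ => φ (r * e θ) := by
          refine HasCompactSupport.intro (isCompact_Icc (a := -R) (b := R)) fun r hr => ?_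
          refine image_eq_zero_of_notMem_tsupport (hR _ ?_)
          rw [norm_mul, hen, mul_one, Complex.norm_real, Real.norm_eq_abs, ← not_le, abs_le]
          exact hr
        have h5 := h4.integral_Ioi_deriv_eq h3 0
        rw [funext fun r => (h1 r).deriv] at h5
        simpa using h5
      rw [integral_congr_ae (Eventually.of_forall this)]
      simp only [integral_const, Complex.real_smul]
      simp only [MeasurableSet.univ, measureReal_restrict_apply, Set.univ_inter,
        Real.volume_real_Ioo, sub_neg_eq_add]
      rw [max_eq_left (by positivity)]
      push_cast
      ring
    · exact hAi.swap
  have hB : ∫ p in Set.Ioi (0 : ℝ) ×ˢ Set.Ioo (-Real.pi) Real.pi, B p = 0 := by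
    rw [Measure.volume_eq_prod, setIntegral_prod _ hBi]
    refine setIntegral_eq_zero_of_forall_eq_zero fun r hr => ?_
    have hr0 : (r : ℂ) ≠ 0 := by exact_mod_cast (ne_of_gt hr)
    have h1 : ∀ θ : ℝ, HasDerivAt (fun θ : ℝ => φ (r * e θ)) (r * B (r, θ)) θ := fun θ => by
      have h2 := (hdiff _).hasFDerivAt.comp_hasDerivAt θ ((hed θ).const_mul (r : ℂ))
      refine h2.congr_deriv ?_
      simp only [B]
      rw [← Complex.real_smul, ← Complex.real_smul, map_smul, Complex.real_smul, Complex.real_smul]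
    have h3 : ∫ θ in (-Real.pi)..Real.pi, (r : ℂ) * B (r, θ) = 0 := by
      rw [intervalIntegral.integral_eq_sub_of_hasDerivAt (fun θ _ => h1 θ)]
      · simp [he]
      · exact Continuous.intervalIntegrable (by fun_prop) _ _
    rw [intervalIntegral.integral_const_mul, mul_eq_zero, or_iff_right hr0,
      intervalIntegral.integral_of_le (by linarith [Real.pi_pos]), integral_Ioc_eq_integral_Ioo]
      at h3
    exact h3
  rw [← Complex.integral_comp_polarCoord_symm, polarCoord_target]
  have hcongr : ∀ p ∈ Set.Ioi (0 : ℝ) ×ˢ Set.Ioo (-Real.pi) Real.pi,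
      p.1 • (dbar φ (Complex.polarCoord.symm p) * (Complex.polarCoord.symm p)⁻¹) =
        A p + Complex.I * B p := by
    rintro ⟨r, θ⟩ ⟨hr, -⟩
    have hr0 : (r : ℂ) ≠ 0 := by exact_mod_cast (ne_of_gt hr)
    rw [Complex.polarCoord_symm_apply, Complex.real_smul, mul_inv]
    have := mul_dbar_eq φ (r * e θ) θ
    simp only [A, B]
    rw [← this]
    simp only [he]
    field_simp
  rw [setIntegral_congr_fun (measurableSet_Ioi.prod measurableSet_Ioo) hcongr,
    integral_add hAi (hBi.const_mul _), integral_const_mul, hA, hB, mul_zero, add_zero]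

/-- The **Cauchy-Pompeiu formula** for compactly supported functions. -/
theorem integral_dbar_mul_inv_sub {ψ : ℂ → ℂ} (hψ : ContDiff ℝ 1 ψ) (hc : HasCompactSupport ψ)
    (z : ℂ) : ∫ w, dbar ψ w * (w - z)⁻¹ = -(2 * Real.pi) * ψ z := by
  have h1 := integral_dbar_mul_inv (φ := fun u => ψ (u + z))
    (hψ.comp (contDiff_id.add contDiff_const))
    (hc.comp_homeomorph (Homeomorph.addRight z))
  rw [← integral_add_right_eq_self _ z]
  simpa [dbar, fderiv_comp_add_right] using h1

end

/-! ### Runge's theorem on simply connected open sets. -/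

section

open MeasureTheory
open scoped Manifold ContDiff

/-- There is no continuous logarithm of `z - a` along a circle around `a`. -/
theorem exists_exp_ne_sub {M : ℂ → ℂ} (hM : Continuous M) (a : ℂ) (R : ℝ) :
    ∃ z, ‖z - a‖ = |R| ∧ Complex.exp (M z) ≠ z - a := by
  by_contra! h
  set c : ℝ → ℂ := fun t => a + R * Complex.exp (t * Complex.I) with hc
  have hn : ∀ t, ‖c t - a‖ = |R| := fun t => by
    simp [hc, Complex.norm_exp_ofReal_mul_I]
  -- Both sides lift the same path through the covering `exp` and agree at `t = 0`. At `t = 2π` the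
  -- path `c` has closed up, but the right side has grown by `2πi`.
  have h1 : (fun t : ℝ => M (c t)) = fun t : ℝ => M (c 0) + t * Complex.I := by
    refine Complex.isCoveringMap_exp.eq_of_comp_eq (by fun_prop) (by fun_prop) ?_ 0 (by simp)
    funext t
    refine Subtype.ext ?_
    simp only [Function.comp_apply, Complex.exp_add, h _ (hn _)]
    simp [hc]
  have h2 := congrFun h1 (2 * Real.pi)
  have h3 : c (2 * Real.pi) = c 0 := by simp [hc, Complex.exp_two_pi_mul_I]
  simp [h3, Real.pi_ne_zero] at h2

/-- The connected components of the complement of a compact subset of a simply connected open set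
`G` which meet the complement of `G` are unbounded. -/
theorem not_isBounded_connectedComponentIn_compl {G K : Set ℂ} (hG : IsSimplyConnected G)
    (hGo : IsOpen G) (hK : IsCompact K) (hKG : K ⊆ G) {a : ℂ} (ha : a ∉ G) :
    ¬ Bornology.IsBounded (connectedComponentIn Kᶜ a) := by
  intro hb
  set V := connectedComponentIn Kᶜ a with hV
  have hVo : IsOpen V := hK.isClosed.isOpen_compl.connectedComponentIn
  have haV : a ∈ V := mem_connectedComponentIn fun h => ha (hKG h)
  have hcl : ∀ z ∈ closure V, z ∉ V → z ∈ K := by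
    intro z hz hzV
    by_contra hzK
    have hzo : IsOpen (connectedComponentIn Kᶜ z) :=
      hK.isClosed.isOpen_compl.connectedComponentIn
    obtain ⟨y, hy1, hy2⟩ := mem_closure_iff.1 hz _ hzo (mem_connectedComponentIn hzK)
    have := (connectedComponentIn_eq hy1).trans (connectedComponentIn_eq hy2).symm
    exact hzV (by rw [hV, ← this]; exact mem_connectedComponentIn hzK)
  -- Boundary points of `V` lie in `K ⊆ G`, so `V` may be replaced by its closure.
  have hA : IsClosed (V \ G) := by
    have : V \ G = closure V \ G := by
      refine Set.Subset.antisymm (Set.sdiff_subset_sdiff_left subset_closure) ?_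
      rintro z ⟨h1, h2⟩
      exact ⟨by_contra fun h => h2 (hKG (hcl z h1 h)), h2⟩
    rw [this]
    exact isClosed_closure.sdiff hGo
  obtain ⟨χ, hχ0, hχ1, -⟩ := exists_contMDiffMap_zero_one_nhds_of_isClosed
    (n := 1) 𝓘(ℝ, ℂ) hA hVo.isClosed_compl
    (Set.disjoint_left.2 fun z h1 h2 => h2 h1.1)
  have hχc : Continuous χ := χ.contMDiff.continuous
  obtain ⟨L, hLc, hL⟩ := Complex.exists_continuousOn_eqOn_exp_comp hG hGo
    (g := fun z => z - a) (by fun_prop)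
    (by rintro ⟨z, hz, h⟩; exact ha (by rwa [← sub_eq_zero.1 h]))
  classical
  -- A zero-free continuous modification of `z - a`: inside `V` it is `(z - a)^χ` via the logarithm
  -- `L` available on `G`, and it is `1` near `V \ G`. A logarithm of `F` on the plane would be one
  -- of `z - a` on a circle enclosing the bounded set `V`.
  let F : ℂ → ℂ := fun z => if z ∈ V then Complex.exp (χ z * L z) else z - a
  have hFG : ∀ z ∈ G, F z = Complex.exp (χ z * L z) := by
    intro z hz
    by_cases hzV : z ∈ V
    · simp [F, hzV]
    · have h1 : χ z = 1 := hχ1.self_of_nhdsSet z hzV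
      have h2 : Complex.exp (L z) = z - a := hL hz
      simp [F, hzV, h1, h2]
  have hFc : Continuous F := by
    refine continuous_iff_continuousAt.2 fun z => ?_
    by_cases hzG : z ∈ G
    · have h1 : ContinuousAt (fun z => Complex.exp (χ z * L z)) z :=
        ((Complex.continuous_ofReal.comp hχc).continuousAt.mul
          (hLc.continuousAt (hGo.mem_nhds hzG))).cexp
      exact h1.congr ((hGo.eventually_mem hzG).mono fun w hw => (hFG w hw).symm)
    by_cases hzV : z ∈ V
    · refine (continuousAt_const (y := (1 : ℂ))).congr ?_
      filter_upwards [eventually_nhdsSet_iff_forall.1 hχ0 z ⟨hzV, hzG⟩, hVo.eventually_mem hzV]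
        with w h1 h2
      simp [F, h1, h2]
    · have hz : z ∉ closure V := fun h => hzG (hKG (hcl z h hzV))
      refine ContinuousAt.congr (f := fun z => z - a) (by fun_prop) ?_
      filter_upwards [isClosed_closure.isOpen_compl.eventually_mem hz] with w hw
      have : w ∉ V := fun h => hw (subset_closure h)
      simp [F, this]
  have hF0 : ∀ z, F z ≠ 0 := by
    intro z
    by_cases hzV : z ∈ V
    · simp [F, hzV]
    · simp only [F, hzV, if_false]
      exact sub_ne_zero.2 fun h => hzV (h ▸ haV)
  obtain ⟨M, hMc, hM⟩ := Complex.exists_continuousOn_eqOn_exp_comp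
    (U := Set.univ)
    ((Homeomorph.Set.univ ℂ).toHomotopyEquiv.simplyConnectedSpace) isOpen_univ (g := F) hFc.continuousOn
    (by rintro ⟨z, -, h⟩; exact hF0 z h)
  obtain ⟨R, hR⟩ := hb.subset_closedBall a
  obtain ⟨z, hz1, hz2⟩ := exists_exp_ne_sub (continuousOn_univ.1 hMc) a (|R| + 1)
  refine hz2 ?_
  have hzV : z ∉ V := fun h => by
    have := hR h
    rw [Metric.mem_closedBall, dist_eq_norm, hz1, abs_of_pos (by positivity)] at this
    linarith [le_abs_self R]
  have := hM (Set.mem_univ z)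
  simpa [F, hzV] using this

/-- A holomorphic function times a cutoff function. -/
theorem exists_cutoff_mul {G σ : Set ℂ} (hGo : IsOpen G) (hσ : IsCompact σ) (hσG : σ ⊆ G)
    {f : ℂ → ℂ} (hf : DifferentiableOn ℂ f G) :
    ∃ ψ : ℂ → ℂ, ContDiff ℝ 1 ψ ∧ HasCompactSupport ψ ∧ ∀ z ∈ σ, ψ =ᶠ[𝓝 z] f := by
  obtain ⟨L, hL, hσL, hLG⟩ := exists_compact_between hσ hGo hσG
  obtain ⟨χ, hχ1, hχ0, -⟩ := exists_contMDiffMap_one_nhds_of_subset_interior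
    (n := 1) 𝓘(ℝ, ℂ) hσ.isClosed hσL
  have hχ : ContDiff ℝ 1 χ := χ.contMDiff.contDiff
  refine ⟨fun w => χ w * f w, contDiff_iff_contDiffAt.2 fun z => ?_,
    HasCompactSupport.intro hL fun z hz => by simp [hχ0 z hz], fun z hz => ?_⟩
  · by_cases hz : z ∈ G
    · have h1 : ContDiffAt ℝ 1 f z :=
        ((hf.contDiffOn hGo).contDiffAt (hGo.mem_nhds hz)).restrict_scalars ℝ
      exact (Complex.ofRealCLM.contDiff.comp hχ).contDiffAt.mul h1
    · refine (contDiffAt_const (c := (0 : ℂ))).congr_of_eventuallyEq ?_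
      filter_upwards [hL.isClosed.isOpen_compl.eventually_mem fun h => hz (hLG h)] with w hw
      simp [hχ0 w hw]
  · filter_upwards [eventually_nhdsSet_iff_forall.1 hχ1 z hz] with w hw
    simp [hw]

/-- **Runge's theorem** for simply connected open sets. -/
theorem exists_polynomial_approx {G K : Set ℂ} (hG : IsSimplyConnected G) (hGo : IsOpen G)
    (hK : IsCompact K) (hKG : K ⊆ G) {f : ℂ → ℂ} (hf : DifferentiableOn ℂ f G) {ε : ℝ}
    (hε : 0 < ε) : ∃ p : Polynomial ℂ, ∀ z ∈ K, ‖f z - p.eval z‖ < ε := by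
  rcases K.eq_empty_or_nonempty with rfl | hKne
  · exact ⟨0, by simp⟩
  have : CompactSpace K := isCompact_iff_compactSpace.1 hK
  have : Nonempty K := hKne.to_subtype
  let x : C(K, ℂ) := ⟨Subtype.val, continuous_subtype_val⟩
  let S : Subalgebra ℂ C(K, ℂ) := Algebra.elemental ℂ x
  have hS : IsClosed (S : Set C(K, ℂ)) := Algebra.elemental.isClosed ℂ x
  have : CompleteSpace S := hS.completeSpace_coe
  let y : S := ⟨x, Algebra.elemental.self_mem ℂ x⟩
  have hx : spectrum ℂ x = K := by
    rw [ContinuousMap.spectrum_eq_range]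
    exact Subtype.range_coe
  have hσc : IsCompact (spectrum ℂ y) := spectrum.isCompact y
  have hKσ : K ⊆ spectrum ℂ y :=
    hx.symm.subset.trans (spectrum.subset_subalgebra y)
  -- Passing from `C(K)` to the closed subalgebra `S` adds to the spectrum only points in bounded
  -- components of the complement of `K`; the component of a point outside `G` is unbounded.
  have hσG : spectrum ℂ y ⊆ G := by
    intro a ha
    by_contra haG
    have := Subalgebra.spectrum_isBounded_connectedComponentIn (hS := hS) S y ha
    change Bornology.IsBounded (connectedComponentIn (spectrum ℂ x)ᶜ a) at this
    rw [hx] at this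
    exact not_isBounded_connectedComponentIn_compl hG hGo hK hKG haG this
  obtain ⟨ψ, hψ, hψc, hψf⟩ := exists_cutoff_mul hGo hσc hσG hf
  -- On the spectrum `Ring.inverse` takes the default value `0`; this is harmless, as `dbar ψ`
  -- vanishes near the spectrum.
  let Φ : ℂ → S := fun w => dbar ψ w • Ring.inverse (algebraMap ℂ S w - y)
  have hdσ : ∀ z ∈ spectrum ℂ y, ∀ᶠ w in 𝓝 z, dbar ψ w = 0 := by
    intro z hz
    filter_upwards [(hψf z hz).eventuallyEq_nhds, hGo.eventually_mem (hσG hz)] with w h1 h2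
    exact dbar_eq_zero ((hf.differentiableAt (hGo.mem_nhds h2)).congr_of_eventuallyEq h1)
  have hΦc : Continuous Φ := by
    refine continuous_iff_continuousAt.2 fun z => ?_
    by_cases hz : z ∈ spectrum ℂ y
    · refine (continuousAt_const (y := (0 : S))).congr ?_
      filter_upwards [hdσ z hz] with w hw
      simp [Φ, hw]
    · obtain ⟨u, hu⟩ := spectrum.notMem_iff.1 hz
      have h1 : ContinuousAt Ring.inverse (algebraMap ℂ S z - y) :=
        hu ▸ NormedRing.inverse_continuousAt u
      have h2 : ContinuousAt (fun w => algebraMap ℂ S w - y) z :=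
        ((continuous_algebraMap ℂ S).sub continuous_const).continuousAt
      exact (continuous_dbar hψ).continuousAt.smul
        (ContinuousAt.comp (f := fun w => algebraMap ℂ S w - y) h1 h2)
  have hΦs : HasCompactSupport Φ := HasCompactSupport.intro hψc fun w hw => by
    simp [Φ, dbar_eq_zero_of_notMem_tsupport hw]
  have hΦi : Integrable Φ := hΦc.integrable_of_hasCompactSupport hΦs
  -- Point evaluations commute with the integral, so Cauchy-Pompeiu gives `g = f` on `K`; hence `f`
  -- lies in the closure of the polynomials.
  let g : S := (-(2 * Real.pi : ℂ)⁻¹) • ∫ w, Φ w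
  have hg : ∀ z : K, (g : C(K, ℂ)) z = f z := by
    intro z
    let ev : S →L[ℂ] ℂ := (ContinuousMap.evalCLM ℂ z).comp S.toSubmodule.subtypeL
    have h1 : ∀ w, ev (Φ w) = dbar ψ w * (w - z)⁻¹ := by
      intro w
      by_cases hw : w ∈ spectrum ℂ y
      · simp [Φ, (hdσ w hw).self_of_nhds]
      · have h2 := Ring.inverse_mul_cancel _ (spectrum.notMem_iff.1 hw)
        have h3 : ev (Ring.inverse (algebraMap ℂ S w - y)) * (w - z) = 1 :=
          congrArg (fun s : S => (s : C(K, ℂ)) z) h2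
        rw [map_smul, smul_eq_mul, eq_inv_of_mul_eq_one_left h3]
    change ev g = f z
    rw [map_smul, ← ev.integral_comp_comm hΦi]
    simp only [h1]
    rw [integral_dbar_mul_inv_sub hψ hψc, (hψf z (hKσ z.2)).self_of_nhds, smul_eq_mul]
    have : (Real.pi : ℂ) ≠ 0 := by exact_mod_cast Real.pi_ne_zero
    field_simp
  have hgcl : (g : C(K, ℂ)) ∈ closure (Algebra.adjoin ℂ {x} : Set C(K, ℂ)) := g.2
  obtain ⟨q, hq, hqg⟩ := Metric.mem_closure_iff.1 hgcl ε hε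
  rw [SetLike.mem_coe, Algebra.adjoin_singleton_eq_range_aeval] at hq
  obtain ⟨p, rfl⟩ := hq
  refine ⟨p, fun z hz => ?_⟩
  have h1 : (Polynomial.aeval x p : C(K, ℂ)) ⟨z, hz⟩ = p.eval z := by
    rw [Polynomial.aeval_continuousMap_apply]
    simp [x]
  rw [← h1, ← hg ⟨z, hz⟩, ← dist_eq_norm]
  exact (ContinuousMap.dist_apply_le_dist _).trans_lt hqg

end

/-! ### The Taylor operators on powers and polynomials. -/

theorem eventuallyEq_ext_holMk {G : Opens ℂ} {F : ℂ → ℂ} (hF : DifferentiableOn ℂ F (G : Set ℂ))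
    (z : G) : ext (holMk F hF : C(G, ℂ)) =ᶠ[𝓝 (z : ℂ)] F := by
  filter_upwards [G.isOpen.mem_nhds z.2] with w hw
  exact ext_apply (holMk F hF : C(G, ℂ)) ⟨w, hw⟩

theorem taylorOp_holMk {G : Opens ℂ} {F : ℂ → ℂ} (hF : DifferentiableOn ℂ F (G : Set ℂ))
    (n : ℕ) (z : G) : (taylorOp G n (holMk F hF) : C(G, ℂ)) z =
      ∑ j ∈ Finset.range (n + 1), iteratedDeriv j F z / (j.factorial : ℂ) * (-(z : ℂ)) ^ j := by
  rw [taylorOp_apply]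
  refine Finset.sum_congr rfl fun j _ => ?_
  rw [(eventuallyEq_ext_holMk hF z).iteratedDeriv_eq]

theorem differentiableOn_zpow_of_zero_notMem {G : Opens ℂ} (h0 : (0 : ℂ) ∉ G) (m : ℤ) :
    DifferentiableOn ℂ (fun z : ℂ => z ^ m) (G : Set ℂ) := fun _ hz =>
  (differentiableAt_zpow.2 (Or.inl fun h => h0 (h ▸ hz))).differentiableWithinAt

/-- The power `z ↦ z ^ m`, `m ∈ ℤ`, as an element of `H(G)`. -/
def zpowH {G : Opens ℂ} (h0 : (0 : ℂ) ∉ G) (m : ℤ) : H G :=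
  holMk (fun z => z ^ m) (differentiableOn_zpow_of_zero_notMem h0 m)

/-- A polynomial as an element of `H(G)`. -/
def polyH (G : Opens ℂ) (p : Polynomial ℂ) : H G :=
  holMk (fun z => p.eval z) p.differentiable.differentiableOn

/-- The eigenvalue of `taylorOp G n` for the eigenvector `z ^ (-k)`. -/
def eigen (k n : ℕ) : ℝ := ∏ i ∈ Finset.range n, (1 + k / (i + 1))

theorem eigen_pos (k n : ℕ) : 0 < eigen k n :=
  Finset.prod_pos fun i _ => by positivity

/-- `eigen k n / (n + 1)` is nondecreasing because `1 + k/(N+1) ≥ (N+2)/(N+1)`. This gives both the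
growth of `eigen` and the decay of its quotients. -/
theorem eigen_mul_le {k : ℕ} (hk : 1 ≤ k) {n N : ℕ} (h : n ≤ N) :
    eigen k n * (N + 1) ≤ eigen k N * (n + 1) := by
  induction N, h using Nat.le_induction with
  | base => exact le_rfl
  | succ N _ ih =>
    have hk' : (1 : ℝ) ≤ k := by exact_mod_cast hk
    have h1 : (N + 2 : ℝ) / (N + 1) ≤ 1 + k / (N + 1) := by
      rw [div_le_iff₀ (by positivity)]
      field_simp
      linarith
    calc eigen k n * ((N + 1 : ℕ) + 1) = (eigen k n * (N + 1)) * ((N + 2) / (N + 1)) := by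
          push_cast; field_simp; ring
      _ ≤ (eigen k N * (n + 1)) * (1 + k / (N + 1)) := by
          gcongr
          exact mul_nonneg (eigen_pos k N).le (by positivity)
      _ = eigen k (N + 1) * (n + 1) := by
          rw [eigen, eigen, Finset.prod_range_succ]; ring

theorem le_eigen {k : ℕ} (hk : 1 ≤ k) (n : ℕ) : (n + 1 : ℝ) ≤ eigen k n := by
  have := eigen_mul_le hk (Nat.zero_le n)
  simpa [eigen] using this

/-- The `j`-th summand is `k(k+1)⋯(k+j-1)/j!`, and the sum telescopes to `C(n+k, n)` (hockey-stick
identity). -/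
theorem sum_eq_eigen (k n : ℕ) :
    ∑ j ∈ Finset.range (n + 1), (∏ i ∈ Finset.range j, ((-k : ℂ) - i)) / (j.factorial : ℂ) *
      (-1) ^ j = (eigen k n : ℂ) := by
  induction n with
  | zero => simp [eigen]
  | succ n ih =>
    have h1 : ∀ m : ℕ, (∏ i ∈ Finset.range m, ((-k : ℂ) - (i + 1 : ℕ))) * (-1) ^ m =
        eigen k m * m.factorial := by
      intro m
      induction m with
      | zero => simp [eigen]
      | succ m ihm =>
        rw [Finset.prod_range_succ, pow_succ]
        rw [show eigen k (m + 1) = eigen k m * (1 + k / (m + 1)) from Finset.prod_range_succ _ _,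
          Nat.factorial_succ]
        have : (m + 1 : ℂ) ≠ 0 := by exact_mod_cast m.succ_ne_zero
        push_cast at ihm ⊢
        field_simp
        linear_combination (m + 1 + k : ℂ) * ihm
    rw [Finset.sum_range_succ, ih, Finset.prod_range_succ', pow_succ,
      show eigen k (n + 1) = eigen k n * (1 + k / (n + 1)) from Finset.prod_range_succ _ _,
      Nat.factorial_succ]
    have h2 : (n + 1 : ℂ) ≠ 0 := by exact_mod_cast n.succ_ne_zero
    have h3 : (n.factorial : ℂ) ≠ 0 := by exact_mod_cast n.factorial_ne_zero
    have h4 := h1 n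
    push_cast at h4 ⊢
    field_simp
    linear_combination (k : ℂ) * h4

theorem taylorOp_zpowH {G : Opens ℂ} (h0 : (0 : ℂ) ∉ G) (k n : ℕ) :
    taylorOp G n (zpowH h0 (-k)) = (eigen k n : ℂ) • zpowH h0 (-k) := by
  refine Subtype.ext (ContinuousMap.ext fun z => ?_)
  have hz : (z : ℂ) ≠ 0 := fun h => h0 (h ▸ z.2)
  rw [zpowH, taylorOp_holMk, ← sum_eq_eigen, Submodule.coe_smul, ContinuousMap.smul_apply,
    holMk_apply, smul_eq_mul, Finset.sum_mul]
  refine Finset.sum_congr rfl fun j _ => ?_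
  rw [iteratedDeriv_eq_iterate, iter_deriv_zpow, zpow_sub₀ hz, zpow_natCast,
    neg_pow (z : ℂ) j]
  push_cast
  field_simp

theorem iteratedDeriv_polynomial (p : Polynomial ℂ) (j : ℕ) (z : ℂ) :
    iteratedDeriv j (fun z => p.eval z) z =
      (j.factorial : ℂ) * (Polynomial.taylor z p).coeff j := by
  have h1 : iteratedDeriv j (fun z => p.eval z) =
      fun z => (Polynomial.derivative^[j] p).eval z := by
    induction j with
    | zero => simp
    | succ j ih =>
      rw [iteratedDeriv_succ, ih, Function.iterate_succ_apply']
      funext z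
      exact Polynomial.deriv _
  rw [h1, Polynomial.taylor_coeff, ← Polynomial.factorial_smul_hasseDeriv]
  simp

/-- For `n ≥ deg p` the sum is the exact Taylor expansion of `p` at `z` with increment `-z`, that
is, `p(0)`. -/
theorem taylorOp_polyH (G : Opens ℂ) {p : Polynomial ℂ} {n : ℕ} (hn : p.natDegree ≤ n)
    (hp : p.eval 0 = 0) : taylorOp G n (polyH G p) = 0 := by
  refine Subtype.ext (ContinuousMap.ext fun z => ?_)
  have h1 : (Polynomial.taylor (z : ℂ) p).natDegree < n + 1 := by
    rw [Polynomial.natDegree_taylor]; omega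
  have h2 := Polynomial.eval_eq_sum_range' h1 (-(z : ℂ))
  rw [Polynomial.taylor_eval, neg_add_cancel, hp] at h2
  rw [polyH, taylorOp_holMk, Submodule.coe_zero, ContinuousMap.zero_apply, h2]
  refine Finset.sum_congr rfl fun j _ => ?_
  have h3 : (j.factorial : ℂ) ≠ 0 := by exact_mod_cast j.factorial_ne_zero
  rw [iteratedDeriv_polynomial]
  field_simp

/-- Cauchy's estimate for `taylorOp`. -/
theorem norm_taylorOp_le {G : Opens ℂ} (e : H G) (n : ℕ) (z : G) {r C A : ℝ} (hr : 0 < r)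
    (hA : 1 ≤ A) (hzA : ‖(z : ℂ)‖ ≤ A * r) (hball : Metric.closedBall (z : ℂ) r ⊆ G)
    (hC : ∀ w : G, (w : ℂ) ∈ Metric.closedBall (z : ℂ) r → ‖(e : C(G, ℂ)) w‖ ≤ C) :
    ‖(taylorOp G n e : C(G, ℂ)) z‖ ≤ (n + 1) * (C * A ^ n) := by
  have hC0 : 0 ≤ C := (norm_nonneg _).trans (hC z (Metric.mem_closedBall_self hr.le))
  rw [taylorOp_apply]
  refine (norm_sum_le _ _).trans ?_
  have : ∀ j ∈ Finset.range (n + 1),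
      ‖iteratedDeriv j (ext (e : C(G, ℂ))) z / (j.factorial : ℂ) * (-(z : ℂ)) ^ j‖ ≤
        C * A ^ n := by
    intro j hj
    have h1 : ‖iteratedDeriv j (ext (e : C(G, ℂ))) z‖ ≤ j.factorial * C / r ^ j := by
      refine Complex.norm_iteratedDeriv_le_of_forall_mem_sphere_norm_le j hr ?_ ?_
      · refine DifferentiableOn.diffContOnCl ?_
        rw [closure_ball _ hr.ne']
        exact (differentiableOn_ext e).mono hball
      · intro w hw
        have hw' := Metric.sphere_subset_closedBall hw
        have := hC ⟨w, hball hw'⟩ hw'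
        rwa [← ext_apply] at this
    have h3 : (0 : ℝ) < j.factorial := by exact_mod_cast j.factorial_pos
    rw [norm_mul, norm_div, norm_pow, norm_neg, Complex.norm_natCast]
    calc _ ≤ (j.factorial * C / r ^ j) / j.factorial * (A * r) ^ j := by gcongr
      _ = C * A ^ j := by rw [mul_pow]; field_simp
      _ ≤ C * A ^ n := by
        gcongr
        exact Nat.lt_succ_iff.1 (Finset.mem_range.1 hj)
  refine (Finset.sum_le_sum this).trans ?_
  simp

/-! ### Topology of `H(G)`. -/

theorem exists_isCompact_of_mem_nhds {G : Opens ℂ} {f : H G} {O : Set (H G)} (hO : O ∈ 𝓝 f) :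
    ∃ K : Set ℂ, IsCompact K ∧ K ⊆ G ∧ ∃ ε > 0, ∀ g : H G,
      (∀ z : G, (z : ℂ) ∈ K → ‖(g : C(G, ℂ)) z - (f : C(G, ℂ)) z‖ < ε) → g ∈ O := by
  obtain ⟨O', hO', hO⟩ := mem_nhds_induced _ _ _ |>.1 hO
  have h1 : (uniformity C(G, ℂ)).HasBasis _ _ :=
    Metric.uniformity_basis_dist.compactConvergenceUniformity
  obtain ⟨⟨K, ε⟩, ⟨hK, hε⟩, h⟩ := (nhds_basis_uniformity' h1).mem_iff.1 hO'
  refine ⟨Subtype.val '' K, hK.image continuous_subtype_val, by rintro _ ⟨z, -, rfl⟩; exact z.2,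
    ε, hε, fun g hg => hO (h fun z hz => ?_)⟩
  have := hg z ⟨z, hz, rfl⟩
  rw [← dist_eq_norm, dist_comm] at this
  exact this

/-- Weierstrass's theorem on locally uniform limits. Closedness makes `H G` completely metrizable,
hence Baire. -/
theorem isClosed_H (G : Opens ℂ) : IsClosed (H G : Set C(G, ℂ)) := by
  refine isClosed_of_closure_subset fun f hf => ?_
  have : (𝓝 f ⊓ 𝓟 (H G : Set C(G, ℂ))).NeBot := mem_closure_iff_clusterPt.1 hf
  have h1 : Tendsto (fun g : C(G, ℂ) => g) (𝓝 f ⊓ 𝓟 (H G : Set C(G, ℂ))) (𝓝 f) :=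
    tendsto_id'.2 inf_le_left
  refine (tendstoLocallyUniformlyOn_ext.1 h1).differentiableOn ?_ G.isOpen
  exact (eventually_mem_principal _).filter_mono inf_le_right

instance baireSpace_H (G : Opens ℂ) : BaireSpace (H G) := by
  have : LocallyCompactSpace G := G.isOpen.isOpenEmbedding_subtypeVal.locallyCompactSpace
  have := IsCompletelyPseudoMetrizableSpace.of_completeSpace_pseudometrizable (X := C(G, ℂ))
  have : IsCompletelyPseudoMetrizableSpace (H G) := (isClosed_H G).isCompletelyPseudoMetrizableSpace
  infer_instance

instance secondCountableTopology_H (G : Opens ℂ) : SecondCountableTopology (H G) := by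
  have : LocallyCompactSpace G := G.isOpen.isOpenEmbedding_subtypeVal.locallyCompactSpace
  exact inferInstanceAs (SecondCountableTopology (H G : Set C(G, ℂ)))

/-! ### Lower limits of graphs and the universality criterion. -/

section GraphLimit

variable {X Y : Type*} [AddCommMonoid X] [Module ℂ X] [TopologicalSpace X]
  [AddCommMonoid Y] [Module ℂ Y] [TopologicalSpace Y]

/-- The lower limit of the graphs of a sequence of operators. -/
def graphLimit [ContinuousAdd X] [ContinuousAdd Y] [ContinuousConstSMul ℂ X]
    [ContinuousConstSMul ℂ Y] (D : ℕ → X →L[ℂ] Y) : Submodule ℂ (X × Y) where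
  -- Asking for all large `n`, not just infinitely many, lets one index serve two vectors at once;
  -- closure under addition rests on this.
  carrier := {t | ∀ O ∈ 𝓝 t, ∀ᶠ n in atTop, ∃ x, (x, D n x) ∈ O}
  add_mem' := by
    intro s t hs ht O hO
    have h1 : Tendsto (fun p : (X × Y) × (X × Y) => p.1 + p.2) (𝓝 (s, t)) (𝓝 (s + t)) :=
      continuous_add.tendsto _
    obtain ⟨U, hU, V, hV, hUV⟩ := mem_nhds_prod_iff.1 (h1 hO)
    filter_upwards [hs U hU, ht V hV] with n ⟨x, hx⟩ ⟨y, hy⟩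
    refine ⟨x + y, ?_⟩
    simpa using hUV (Set.mk_mem_prod hx hy)
  zero_mem' := fun O hO => Eventually.of_forall fun n => ⟨0, by
    rw [map_zero]; exact mem_of_mem_nhds hO⟩
  smul_mem' := by
    intro c t ht O hO
    have h1 : Tendsto (fun p : X × Y => c • p) (𝓝 t) (𝓝 (c • t)) :=
      (continuous_const_smul c).tendsto _
    filter_upwards [ht _ (h1 hO)] with n ⟨x, hx⟩
    exact ⟨c • x, by simpa using hx⟩

variable [ContinuousAdd X] [ContinuousAdd Y] [ContinuousConstSMul ℂ X]
  [ContinuousConstSMul ℂ Y] {D : ℕ → X →L[ℂ] Y}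

theorem isClosed_graphLimit : IsClosed (graphLimit D : Set (X × Y)) := by
  refine isClosed_of_closure_subset fun t ht O hO => ?_
  obtain ⟨s, hsO, hs⟩ := mem_closure_iff.1 ht _ isOpen_interior (mem_interior_iff_mem_nhds.2 hO)
  exact hs O (mem_interior_iff_mem_nhds.1 hsO)

theorem mem_graphLimit_of_tendsto {x : ℕ → X} {a : X} {b : Y}
    (h1 : Tendsto x atTop (𝓝 a)) (h2 : Tendsto (fun n => D n (x n)) atTop (𝓝 b)) :
    (a, b) ∈ graphLimit D := fun _ hO =>
  ((h1.prodMk_nhds h2).eventually hO).mono fun n hn => ⟨x n, hn⟩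

/-- The **universality criterion**: if the graphs accumulate everywhere, then some orbit is
dense. -/
theorem isUniversal_of_graphLimit_eq_top [BaireSpace X] [SecondCountableTopology Y]
    (h : graphLimit D = ⊤) : IsUniversal D := by
  have hmem : ∀ t : X × Y, t ∈ graphLimit D := fun t => h ▸ Submodule.mem_top
  let b := countableBasis Y
  have hopen : ∀ U ∈ b, IsOpen (⋃ n, D n ⁻¹' U) := fun U hU =>
    isOpen_iUnion fun n => (isOpen_of_mem_countableBasis hU).preimage (D n).continuous
  have hdense : ∀ U ∈ b, Dense (⋃ n, D n ⁻¹' U) := fun U hU => by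
    refine dense_iff_inter_open.2 fun W hW ⟨f, hf⟩ => ?_
    obtain ⟨y, hy⟩ := nonempty_of_mem_countableBasis hU
    obtain ⟨n, x, hx⟩ := (hmem (f, y) (W ×ˢ U)
      ((hW.prod (isOpen_of_mem_countableBasis hU)).mem_nhds ⟨hf, hy⟩)).exists
    exact ⟨x, hx.1, Set.mem_iUnion.2 ⟨n, hx.2⟩⟩
  obtain ⟨x, hx⟩ := (dense_biInter_of_isOpen hopen (countable_countableBasis Y) hdense).nonempty
  refine ⟨x, (isBasis_countableBasis Y).dense_iff.2 fun U hU hne => ?_⟩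
  obtain ⟨n, hn⟩ := Set.mem_iUnion.1 (Set.mem_iInter₂.1 hx U hU)
  exact ⟨D n x, hn, n, rfl⟩

end GraphLimit

instance continuousAdd_H (G : Opens ℂ) : ContinuousAdd (H G) :=
  (H G).toAddSubmonoid.continuousAdd

/-! ### Dense families in `H(G)`. -/

section Density

variable {G : Opens ℂ}

theorem polyH_apply (p : Polynomial ℂ) (z : G) : (polyH G p : C(G, ℂ)) z = p.eval (z : ℂ) := rfl

theorem zpowH_apply (h0 : (0 : ℂ) ∉ G) (m : ℤ) (z : G) :
    (zpowH h0 m : C(G, ℂ)) z = (z : ℂ) ^ m := rfl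

theorem exists_norm_le_of_isCompact {K : Set ℂ} (hK : IsCompact K) {f : ℂ → ℂ}
    (hf : ContinuousOn f K) : ∃ B > 0, ∀ z ∈ K, ‖f z‖ ≤ B := by
  obtain ⟨B, hB⟩ := hK.exists_bound_of_continuousOn hf
  exact ⟨max B 1, by positivity, fun z hz => (hB z hz).trans (le_max_left _ _)⟩

/-- The polynomials vanishing at `0` are dense. -/
theorem mem_closure_range_polyH (hG : IsSimplyConnected (G : Set ℂ)) (h0 : (0 : ℂ) ∉ G)
    (f : H G) : f ∈ closure (Set.range fun p : Polynomial ℂ => polyH G (Polynomial.X * p)) := by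
  refine mem_closure_iff_nhds.2 fun O hO => ?_
  obtain ⟨K, hK, hKG, ε, hε, hO⟩ := exists_isCompact_of_mem_nhds hO
  obtain ⟨B, hB, hKB⟩ := exists_norm_le_of_isCompact hK continuousOn_id
  have hne : ∀ z ∈ (G : Set ℂ), z ≠ 0 := fun z hz h => h0 (h ▸ hz)
  -- Approximating `f(z)/z` and multiplying back by `z` forces the value `0` at `0`.
  obtain ⟨p, hp⟩ := exists_polynomial_approx hG G.isOpen hK hKG
    ((differentiableOn_ext f).div differentiableOn_id hne) (div_pos hε hB)
  refine ⟨_, hO _ fun z hz => ?_, p, rfl⟩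
  have h1 := hp z hz
  have h2 : (z : ℂ) ≠ 0 := hne z z.2
  simp only [Pi.div_apply, ext_apply, id] at h1
  have h3 : (polyH G (Polynomial.X * p) : C(G, ℂ)) z - (f : C(G, ℂ)) z =
      -((z : ℂ) * ((f : C(G, ℂ)) z / z - p.eval (z : ℂ))) := by
    rw [polyH_apply, Polynomial.eval_mul, Polynomial.eval_X]
    field_simp
    ring
  rw [h3, norm_neg, norm_mul]
  calc _ ≤ B * ‖(f : C(G, ℂ)) z / z - p.eval (z : ℂ)‖ := by gcongr; exact hKB z hz
    _ < B * (ε / B) := by gcongr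
    _ = ε := by field_simp

theorem isOpen_inv_preimage (h0 : (0 : ℂ) ∉ G) : IsOpen ((·⁻¹) ⁻¹' (G : Set ℂ) : Set ℂ) := by
  refine isOpen_iff_mem_nhds.2 fun z hz => ?_
  have hz0 : z ≠ 0 := fun h => h0 (by simpa [h] using hz)
  exact (continuousAt_inv₀ hz0).preimage_mem_nhds (G.isOpen.mem_nhds hz)

theorem isSimplyConnected_inv_preimage (hG : IsSimplyConnected (G : Set ℂ))
    (h0 : (0 : ℂ) ∉ G) : IsSimplyConnected ((·⁻¹) ⁻¹' (G : Set ℂ) : Set ℂ) := by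
  have hne : ∀ z : ℂ, z⁻¹ ∈ G → z ≠ 0 := fun z hz h => h0 (by simpa [h] using hz)
  let e : ((·⁻¹) ⁻¹' (G : Set ℂ) : Set ℂ) ≃ₜ (G : Set ℂ) :=
    { toFun := fun z => ⟨(z : ℂ)⁻¹, z.2⟩
      invFun := fun z => ⟨(z : ℂ)⁻¹, by simp⟩
      left_inv := fun z => by simp
      right_inv := fun z => by simp
      continuous_toFun := continuous_induced_rng.2
        (continuous_subtype_val.inv₀ fun z => hne z z.2)
      continuous_invFun := continuous_induced_rng.2
        (continuous_subtype_val.inv₀ fun z h => h0 (h ▸ z.2)) }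
  exact e.toHomotopyEquiv.simplyConnectedSpace_iff.2 hG

/-- The negative powers of `z` span a dense subspace. -/
theorem eq_top_of_zpowH_mem (hG : IsSimplyConnected (G : Set ℂ)) (h0 : (0 : ℂ) ∉ G)
    {N : Submodule ℂ (H G)} (hN : IsClosed (N : Set (H G)))
    (h : ∀ k : ℕ, 1 ≤ k → zpowH h0 (-k) ∈ N) : N = ⊤ := by
  refine Submodule.eq_top_iff'.2 fun f => ?_
  rw [← SetLike.mem_coe, ← hN.closure_eq]
  refine mem_closure_iff_nhds.2 fun O hO => ?_
  obtain ⟨K, hK, hKG, ε, hε, hO⟩ := exists_isCompact_of_mem_nhds hO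
  have hne : ∀ z ∈ (G : Set ℂ), z ≠ 0 := fun z hz h => h0 (h ▸ hz)
  have hne' : ∀ z ∈ ((·⁻¹) ⁻¹' (G : Set ℂ) : Set ℂ), z ≠ 0 := fun z hz h =>
    h0 (by simpa [h] using hz)
  have hinv : ContinuousOn (fun z : ℂ => z⁻¹) K := continuousOn_inv₀.mono fun z hz =>
    hne z (hKG hz)
  obtain ⟨B, hB, hKB⟩ := exists_norm_le_of_isCompact hK hinv
  have hd : DifferentiableOn ℂ (fun w : ℂ => w⁻¹) ((·⁻¹) ⁻¹' (G : Set ℂ) : Set ℂ) :=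
    fun w hw => (differentiableAt_inv (hne' w hw)).differentiableWithinAt
  -- With `w = 1/z`, approximating `f(1/w)/w` and multiplying by `w` leaves only powers `z^(-k)`
  -- with `k ≥ 1`.
  have hf : DifferentiableOn ℂ (fun w => ext (f : C(G, ℂ)) w⁻¹ * w⁻¹)
      ((·⁻¹) ⁻¹' (G : Set ℂ) : Set ℂ) :=
    ((differentiableOn_ext f).comp hd fun w hw => hw).mul hd
  obtain ⟨p, hp⟩ := exists_polynomial_approx (isSimplyConnected_inv_preimage hG h0)
    (isOpen_inv_preimage h0) (hK.image_of_continuousOn hinv)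
    (by rintro _ ⟨z, hz, rfl⟩; simpa using hKG hz) hf (div_pos hε hB)
  refine ⟨∑ i ∈ Finset.range (p.natDegree + 1), p.coeff i • zpowH h0 (-((i + 1 : ℕ) : ℤ)),
    hO _ fun z hz => ?_, N.sum_mem fun i _ => N.smul_mem _ (h _ (Nat.le_add_left _ _))⟩
  have h2 : (z : ℂ) ≠ 0 := hne z z.2
  have h1 := hp _ ⟨z, hz, rfl⟩
  simp only [inv_inv, ext_apply] at h1
  have h3 : ((∑ i ∈ Finset.range (p.natDegree + 1),
      p.coeff i • zpowH h0 (-((i + 1 : ℕ) : ℤ)) : H G) : C(G, ℂ)) z =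
        (z : ℂ)⁻¹ * p.eval (z : ℂ)⁻¹ := by
    rw [Submodule.coe_sum, ContinuousMap.sum_apply, Polynomial.eval_eq_sum_range, Finset.mul_sum]
    refine Finset.sum_congr rfl fun i _ => ?_
    rw [Submodule.coe_smul, ContinuousMap.smul_apply, zpowH_apply, smul_eq_mul, zpow_neg,
      zpow_natCast, pow_succ, inv_pow]
    field_simp
  rw [h3]
  have h4 : (z : ℂ)⁻¹ * p.eval (z : ℂ)⁻¹ - (f : C(G, ℂ)) z =
      -((z : ℂ)⁻¹ * ((f : C(G, ℂ)) z * z - p.eval (z : ℂ)⁻¹)) := by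
    field_simp
    ring
  rw [h4, norm_neg, norm_mul]
  calc _ ≤ B * ‖(f : C(G, ℂ)) z * z - p.eval (z : ℂ)⁻¹‖ := by gcongr; exact hKB z hz
    _ < B * (ε / B) := by gcongr
    _ = ε := by field_simp

end Density

/-! ### Geometric approximation of negative powers. -/

theorem norm_one_sub_one_sub_pow_le {w : ℂ} (hw : ‖w‖ ≤ 1) (m : ℕ) :
    ‖1 - (1 - w) ^ m‖ ≤ 2 ^ m * ‖w‖ := by
  induction m with
  | zero => simp
  | succ m ih =>
    have h1 : ‖1 - w‖ ≤ 2 := (norm_sub_le _ _).trans (by rw [norm_one]; linarith)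
    calc ‖1 - (1 - w) ^ (m + 1)‖ = ‖(1 - (1 - w) ^ m) + (1 - w) ^ m * w‖ := by ring_nf
      _ ≤ ‖1 - (1 - w) ^ m‖ + ‖1 - w‖ ^ m * ‖w‖ := by
        rw [← norm_pow, ← norm_mul]; exact norm_add_le _ _
      _ ≤ 2 ^ m * ‖w‖ + 2 ^ m * ‖w‖ := by gcongr
      _ = 2 ^ (m + 1) * ‖w‖ := by ring

/-- On a compact set, `z ^ (-k)` is approximated with geometric speed by polynomials vanishing
at `0`. -/
theorem exists_polynomial_approx_zpow {G L : Set ℂ} (hG : IsSimplyConnected G) (hGo : IsOpen G)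
    (h0 : (0 : ℂ) ∉ G) (hL : IsCompact L) (hLG : L ⊆ G) (k : ℕ) :
    ∃ C > 0, ∃ d : ℕ, ∀ M : ℕ, ∃ q : Polynomial ℂ, q.natDegree ≤ d * (M + 1) ∧ q.eval 0 = 0 ∧
      ∀ z ∈ L, ‖z ^ (-k : ℤ) - q.eval z‖ ≤ C * (1 / 2) ^ M := by
  have hne : ∀ z ∈ G, z ≠ 0 := fun z hz h => h0 (h ▸ hz)
  obtain ⟨B, hB, hLB⟩ := exists_norm_le_of_isCompact hL continuousOn_id
  obtain ⟨B', hB', hLB'⟩ := exists_norm_le_of_isCompact hL (f := fun z : ℂ => z ^ (-k : ℤ))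
    fun z hz => (continuousAt_zpow₀ z _ (Or.inl (hne z (hLG hz)))).continuousWithinAt
  obtain ⟨p, hp⟩ := exists_polynomial_approx hG hGo hL hLG (f := fun z => z⁻¹)
    (fun z hz => (differentiableAt_inv (hne z hz)).differentiableWithinAt)
    (ε := 1 / (2 * B)) (by positivity)
  have hw : ∀ z ∈ L, ‖1 - z * p.eval z‖ ≤ 1 / 2 := fun z hz => by
    have hz0 := hne z (hLG hz)
    have : 1 - z * p.eval z = z * (z⁻¹ - p.eval z) := by field_simp
    rw [this, norm_mul]
    calc _ ≤ B * (1 / (2 * B)) := by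
          gcongr
          · exact hLB z hz
          · exact (hp z hz).le
      _ = 1 / 2 := by field_simp
  -- A truncated Neumann series for `1/z`, built from `p ≈ 1/z`: the defect `1 - z s_M = (1 - z
  -- p)^M` is at most `2^(-M)` on `L`.
  let s : ℕ → Polynomial ℂ := fun M =>
    p * ∑ i ∈ Finset.range M, (1 - Polynomial.X * p) ^ i
  have hs : ∀ M, Polynomial.X * s M = 1 - (1 - Polynomial.X * p) ^ M := fun M => by
    have := mul_neg_geom_sum (1 - Polynomial.X * p) M
    rw [← this]
    ring
  have hdeg1 : (1 - Polynomial.X * p).natDegree ≤ p.natDegree + 1 := by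
    refine (Polynomial.natDegree_sub_le _ _).trans (max_le (by simp) ?_)
    refine Polynomial.natDegree_mul_le.trans ?_
    rw [Polynomial.natDegree_X, add_comm]
  have hdeg : ∀ M, (s M).natDegree ≤ (p.natDegree + 1) * (M + 1) := fun M => by
    have h1 : (∑ i ∈ Finset.range M, (1 - Polynomial.X * p) ^ i).natDegree ≤
        M * (p.natDegree + 1) := by
      refine Polynomial.natDegree_sum_le_of_forall_le _ _ fun i hi => ?_
      refine (Polynomial.natDegree_pow_le_of_le i hdeg1).trans ?_
      gcongr
      exact (Finset.mem_range.1 hi).le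
    refine (Polynomial.natDegree_mul_le_of_le le_rfl h1).trans ?_
    linarith
  -- `z s^(k+1) = z^(-k) (z s)^(k+1)` is close to `z^(-k)`, and the extra factor `z` makes it vanish
  -- at `0`.
  refine ⟨B' * 2 ^ (k + 1), by positivity, 1 + (k + 1) * (p.natDegree + 1), fun M =>
    ⟨Polynomial.X * s M ^ (k + 1), ?_, by simp, fun z hz => ?_⟩⟩
  · refine (Polynomial.natDegree_mul_le_of_le Polynomial.natDegree_X_le
      (Polynomial.natDegree_pow_le_of_le (k + 1) (hdeg M))).trans ?_
    rw [add_mul 1 ((k + 1) * (p.natDegree + 1)), one_mul, mul_assoc (k + 1)]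
    exact Nat.add_le_add_right (Nat.le_add_left 1 M) _
  · have hz0 := hne z (hLG hz)
    set w := (1 - z * p.eval z) ^ M with hwdef
    have h1 : ‖w‖ ≤ (1 / 2) ^ M := by
      rw [hwdef, norm_pow]
      gcongr
      exact hw z hz
    have h2 : z * (s M).eval z = 1 - w := by
      have := congrArg (Polynomial.eval z) (hs M)
      simpa using this
    have h3 : z ^ (-k : ℤ) - (Polynomial.X * s M ^ (k + 1)).eval z =
        z ^ (-k : ℤ) * (1 - (1 - w) ^ (k + 1)) := by
      rw [← h2, zpow_neg, zpow_natCast]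
      simp only [Polynomial.eval_mul, Polynomial.eval_X, Polynomial.eval_pow]
      field_simp
      ring
    rw [h3, norm_mul, mul_assoc]
    gcongr
    · exact hLB' z hz
    · refine (norm_one_sub_one_sub_pow_le (h1.trans (pow_le_one₀ (by norm_num) (by norm_num)))
        _).trans ?_
      gcongr

/-! ### First and third coordinates. -/

section Limits

variable {G : Opens ℂ} {l₁ l₂ : ℕ → ℕ}

/-- The pair of operators `(taylorOp G (l₁ n), taylorOp G (l₂ n))`. -/
abbrev pairOp (G : Opens ℂ) (l₁ l₂ : ℕ → ℕ) (n : ℕ) : H G →L[ℂ] H G × H G :=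
  (taylorOp G (l₁ n)).prod (taylorOp G (l₂ n))

theorem tendsto_of_tendsto_div (hl₁ : ∀ n, 0 < l₁ n) (hlim₁ : Tendsto l₁ atTop atTop)
    (hlim₂ : Tendsto (fun n => (l₂ n : ℝ) / (l₁ n : ℝ)) atTop atTop) :
    Tendsto l₂ atTop atTop := by
  have h1 : Tendsto (fun n => (l₁ n : ℝ)) atTop atTop := tendsto_natCast_atTop_atTop.comp hlim₁
  have h2 := h1.atTop_mul_atTop₀ hlim₂
  refine tendsto_natCast_atTop_iff (R := ℝ) |>.1 (h2.congr fun n => ?_)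
  have : (l₁ n : ℝ) ≠ 0 := by exact_mod_cast (hl₁ n).ne'
  field_simp

theorem eventually_mul_le (hl₁ : ∀ n, 0 < l₁ n)
    (hlim₂ : Tendsto (fun n => (l₂ n : ℝ) / (l₁ n : ℝ)) atTop atTop) (m : ℕ) :
    ∀ᶠ n in atTop, m * l₁ n ≤ l₂ n := by
  filter_upwards [hlim₂.eventually_ge_atTop (m : ℝ)] with n hn
  rw [le_div_iff₀ (by exact_mod_cast hl₁ n)] at hn
  exact_mod_cast hn

theorem polyH_mem_graphLimit (hl₁ : Tendsto l₁ atTop atTop) (hl₂ : Tendsto l₂ atTop atTop)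
    {p : Polynomial ℂ} (hp : p.eval 0 = 0) :
    (polyH G p, (0 : H G × H G)) ∈ graphLimit (pairOp G l₁ l₂) := by
  refine mem_graphLimit_of_tendsto (tendsto_const_nhds (x := polyH G p)) ?_
  refine tendsto_const_nhds.congr' ?_
  filter_upwards [hl₁.eventually_ge_atTop p.natDegree, hl₂.eventually_ge_atTop p.natDegree]
    with n h1 h2
  simp [taylorOp_polyH G h1 hp, taylorOp_polyH G h2 hp, Prod.zero_eq_mk]

theorem zpowH_snd_mem_graphLimit (h0 : (0 : ℂ) ∉ G) (hl₁ : ∀ n, 0 < l₁ n)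
    (hlim₁ : Tendsto l₁ atTop atTop)
    (hlim₂ : Tendsto (fun n => (l₂ n : ℝ) / (l₁ n : ℝ)) atTop atTop) {k : ℕ} (hk : 1 ≤ k) :
    ((0 : H G), (0 : H G), zpowH h0 (-k)) ∈ graphLimit (pairOp G l₁ l₂) := by
  have hl₂ := tendsto_of_tendsto_div hl₁ hlim₁ hlim₂
  have hev := eventually_mul_le hl₁ hlim₂ 1
  have h1 : Tendsto (fun n => (eigen k (l₂ n))⁻¹) atTop (𝓝 0) := by
    have : Tendsto (fun n => (l₂ n : ℝ)) atTop atTop := tendsto_natCast_atTop_atTop.comp hl₂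
    refine (tendsto_atTop_mono (fun n => ?_) this).inv_tendsto_atTop
    linarith [le_eigen hk (l₂ n)]
  have h2 : Tendsto (fun n => (eigen k (l₂ n))⁻¹ * eigen k (l₁ n)) atTop (𝓝 0) := by
    -- The factor `2` comes from `(λ₁+1)/(λ₂+1) ≤ 2λ₁/λ₂`, valid as `λ₁ ≥ 1`.
    have h3 : Tendsto (fun n => 2 * ((l₂ n : ℝ) / l₁ n)⁻¹) atTop (𝓝 0) := by
      simpa using hlim₂.inv_tendsto_atTop.const_mul 2
    refine tendsto_of_tendsto_of_tendsto_of_le_of_le' tendsto_const_nhds h3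
      (Eventually.of_forall fun n =>
        mul_nonneg (inv_nonneg.2 (eigen_pos _ _).le) (eigen_pos _ _).le) ?_
    filter_upwards [hev] with n hn
    rw [one_mul] at hn
    have h4 := eigen_mul_le hk hn
    have h5 : (1 : ℝ) ≤ l₁ n := by exact_mod_cast hl₁ n
    have h6 : (0 : ℝ) < l₂ n := by exact_mod_cast (hl₁ n).trans_le hn
    have h7 := eigen_pos k (l₂ n)
    have h8 := eigen_pos k (l₁ n)
    rw [inv_div, inv_mul_le_iff₀ h7, mul_div_assoc', mul_div_assoc', le_div_iff₀ h6]
    nlinarith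
  have hc : ∀ {c : ℕ → ℝ} {a : ℝ}, Tendsto c atTop (𝓝 a) →
      Tendsto (fun n => (c n : ℂ) • zpowH h0 (-k)) atTop (𝓝 ((a : ℂ) • zpowH h0 (-k))) :=
    fun h => ((Complex.continuous_ofReal.tendsto _).comp h).smul_const _
  refine mem_graphLimit_of_tendsto (x := fun n => (((eigen k (l₂ n))⁻¹ : ℝ) : ℂ) • zpowH h0 (-k)) ?_ ?_
  · simpa using hc h1
  · have h3 : Tendsto (fun n => (eigen k (l₂ n))⁻¹ * eigen k (l₂ n)) atTop (𝓝 1) :=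
      tendsto_const_nhds.congr fun n => (inv_mul_cancel₀ (eigen_pos k (l₂ n)).ne').symm
    have h4 := (hc h2).prodMk_nhds (hc h3)
    simp only [Complex.ofReal_zero, Complex.ofReal_one, zero_smul, one_smul] at h4
    refine h4.congr fun n => ?_
    simp only [ContinuousLinearMap.prod_apply]
    simp only [map_smul, taylorOp_zpowH, smul_smul, Complex.ofReal_mul]

end Limits

/-! ### Second coordinate and conclusion. -/

section MiddleFactor

variable {G : Opens ℂ} {l₁ l₂ : ℕ → ℕ}

/-- On a compact set `K`, the triple `(0, z ^ (-k), 0)` is approximated by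
`(u, taylorOp G (l₁ n) u, taylorOp G (l₂ n) u)`. -/
theorem eventually_exists_approx_zpowH_fst (hG : IsSimplyConnected (G : Set ℂ))
    (h0 : (0 : ℂ) ∉ G) (hl₁ : ∀ n, 0 < l₁ n) (hlim₁ : Tendsto l₁ atTop atTop)
    (hlim₂ : Tendsto (fun n => (l₂ n : ℝ) / (l₁ n : ℝ)) atTop atTop) {k : ℕ} (hk : 1 ≤ k)
    {K : Set ℂ} (hK : IsCompact K) (hKG : K ⊆ G) {ε : ℝ} (hε : 0 < ε) :
    ∀ᶠ n in atTop, ∃ u : H G, taylorOp G (l₂ n) u = 0 ∧ ∀ z : G, (z : ℂ) ∈ K →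
      ‖(u : C(G, ℂ)) z‖ < ε ∧
      ‖(taylorOp G (l₁ n) u : C(G, ℂ)) z - (zpowH h0 (-k) : C(G, ℂ)) z‖ < ε := by
  -- The thickening leaves room for Cauchy discs of one radius `r` around all points of `K`.
  obtain ⟨r, hr, hrG⟩ := hK.exists_cthickening_subset_open G.isOpen hKG
  set L := Metric.cthickening r K with hLdef
  have hL : IsCompact L := hK.cthickening
  have hKL : K ⊆ L := Metric.self_subset_cthickening K
  have hball : ∀ z ∈ K, Metric.closedBall z r ⊆ L := fun z hz =>
    Metric.closedBall_subset_cthickening hz r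
  obtain ⟨C, hC, d, hq⟩ := exists_polynomial_approx_zpow hG G.isOpen h0 hL hrG k
  obtain ⟨B, hB, hKB⟩ := exists_norm_le_of_isCompact hK continuousOn_id
  have hzc : ContinuousOn (fun z : ℂ => z ^ (-k : ℤ)) K :=
    (differentiableOn_zpow_of_zero_notMem h0 _).continuousOn.mono hKG
  obtain ⟨B', hB', hKB'⟩ := exists_norm_le_of_isCompact hK hzc
  set A := 1 + B / r with hAdef
  have hA : 1 ≤ A := by rw [hAdef]; linarith [div_pos hB hr]
  have hBA : B ≤ A * r := by rw [hAdef, add_mul, div_mul_cancel₀ _ hr.ne']; linarith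
  -- With `2^m > 2A`, the error `2^(-m λ₁)` times the Cauchy loss `A^λ₁` is at most `2^(-λ₁)`.
  obtain ⟨m, hm⟩ := pow_unbounded_of_one_lt (2 * A) (one_lt_two (α := ℝ))
  have hl₁' : Tendsto (fun n => (l₁ n : ℝ)) atTop atTop := tendsto_natCast_atTop_atTop.comp hlim₁
  have hpow : Tendsto (fun n => C * (1 / 2 : ℝ) ^ l₁ n) atTop (𝓝 0) := by
    simpa using ((tendsto_pow_atTop_nhds_zero_of_lt_one (r := (1 / 2 : ℝ)) (by norm_num)
      (by norm_num)).comp hlim₁).const_mul C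
  filter_upwards [eventually_mul_le hl₁ hlim₂ (d * (m + 1)), hpow.eventually_lt_const hε,
    hl₁'.eventually_gt_atTop ((B' + C) / ε)] with n hn1 hn2 hn3
  obtain ⟨q, hqd, hq0, hqL⟩ := hq (m * l₁ n)
  set c := eigen k (l₁ n) with hcdef
  have hc : 0 < c := eigen_pos _ _
  have hlc : (l₁ n + 1 : ℝ) ≤ c := le_eigen hk _
  have hc0 : (c : ℂ) ≠ 0 := by exact_mod_cast hc.ne'
  have hnc : ‖(c : ℂ)⁻¹‖ = c⁻¹ := by
    rw [norm_inv, Complex.norm_real, Real.norm_eq_abs, abs_of_pos hc]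
  -- `d(mλ₁ + 1) ≤ d(m+1)λ₁ ≤ λ₂`, so `T̃_{λ₂}` annihilates `q`.
  have hqdeg : q.natDegree ≤ l₂ n := by
    refine hqd.trans (le_trans ?_ hn1)
    rw [mul_assoc]
    gcongr
    rw [add_mul, one_mul]
    exact Nat.add_le_add_left (hl₁ n) _
  refine ⟨(c : ℂ)⁻¹ • polyH G q, by rw [map_smul, taylorOp_polyH G hqdeg hq0, smul_zero],
    fun z hz => ⟨?_, ?_⟩⟩
  · have h1 : ‖q.eval (z : ℂ)‖ ≤ B' + C := by
      have h2 := hqL z (hKL hz)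
      have h3 : C * (1 / 2 : ℝ) ^ (m * l₁ n) ≤ C :=
        mul_le_of_le_one_right hC.le (pow_le_one₀ (by norm_num) (by norm_num))
      calc ‖q.eval (z : ℂ)‖ = ‖(z : ℂ) ^ (-k : ℤ) - ((z : ℂ) ^ (-k : ℤ) - q.eval (z : ℂ))‖ := by
            rw [sub_sub_cancel]
        _ ≤ ‖(z : ℂ) ^ (-k : ℤ)‖ + ‖(z : ℂ) ^ (-k : ℤ) - q.eval (z : ℂ)‖ := norm_sub_le _ _
        _ ≤ B' + C := add_le_add (hKB' z hz) (h2.trans h3)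
    rw [Submodule.coe_smul, ContinuousMap.smul_apply, polyH_apply, norm_smul, hnc,
      inv_mul_lt_iff₀ hc]
    rw [div_lt_iff₀ hε] at hn3
    nlinarith
  · have h1 : taylorOp G (l₁ n) ((c : ℂ)⁻¹ • polyH G q) - zpowH h0 (-k) =
        -((c : ℂ)⁻¹ • taylorOp G (l₁ n) (zpowH h0 (-k) - polyH G q)) := by
      have h2 := map_sub (taylorOp G (l₁ n)) (zpowH h0 (-k)) (polyH G q)
      rw [h2, taylorOp_zpowH, smul_sub, inv_smul_smul₀ hc0, map_smul]
      exact (neg_sub (zpowH h0 (-k)) ((c : ℂ)⁻¹ • taylorOp G (l₁ n) (polyH G q))).symm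
    rw [← ContinuousMap.sub_apply, ← Submodule.coe_sub, h1, Submodule.coe_neg,
      ContinuousMap.neg_apply, norm_neg, Submodule.coe_smul, ContinuousMap.smul_apply, norm_smul,
      hnc, inv_mul_lt_iff₀ hc]
    have h2 := norm_taylorOp_le (zpowH h0 (-k) - polyH G q) (l₁ n) z hr hA
      ((hKB z hz).trans hBA) ((hball z hz).trans hrG) (C := C * (1 / 2) ^ (m * l₁ n))
      fun w hw => hqL w (hball z hz hw)
    have h3 : C * (1 / 2) ^ (m * l₁ n) * A ^ l₁ n ≤ C * (1 / 2) ^ l₁ n := by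
      rw [mul_assoc, pow_mul, ← mul_pow]
      gcongr
      rw [one_div, inv_pow, inv_mul_le_iff₀ (by positivity)]
      linarith
    -- The number `λ₁ + 1` of terms in the Cauchy estimate is absorbed by the eigenvalue `c ≥ λ₁ +
    -- 1`.
    calc _ ≤ (l₁ n + 1) * (C * (1 / 2) ^ (m * l₁ n) * A ^ l₁ n) := h2
      _ ≤ c * (C * (1 / 2) ^ l₁ n) := by gcongr
      _ < c * ε := by gcongr

theorem zpowH_fst_mem_graphLimit (hG : IsSimplyConnected (G : Set ℂ))
    (h0 : (0 : ℂ) ∉ G) (hl₁ : ∀ n, 0 < l₁ n) (hlim₁ : Tendsto l₁ atTop atTop)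
    (hlim₂ : Tendsto (fun n => (l₂ n : ℝ) / (l₁ n : ℝ)) atTop atTop) {k : ℕ} (hk : 1 ≤ k) :
    ((0 : H G), zpowH h0 (-k), (0 : H G)) ∈ graphLimit (pairOp G l₁ l₂) := by
  intro O hO
  obtain ⟨O₀, hO₀, O', hO', hOO⟩ := mem_nhds_prod_iff.1 hO
  obtain ⟨O₁, hO₁, O₂, hO₂, hOO'⟩ := mem_nhds_prod_iff.1 hO'
  obtain ⟨K₀, hK₀, hKG₀, ε₀, hε₀, h₀⟩ := exists_isCompact_of_mem_nhds hO₀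
  obtain ⟨K₁, hK₁, hKG₁, ε₁, hε₁, h₁⟩ := exists_isCompact_of_mem_nhds hO₁
  filter_upwards [eventually_exists_approx_zpowH_fst hG h0 hl₁ hlim₁ hlim₂ hk (hK₀.union hK₁)
    (Set.union_subset hKG₀ hKG₁) (lt_min hε₀ hε₁)] with n ⟨u, hu, hK⟩
  refine ⟨u, hOO ⟨h₀ u fun z hz => ?_, hOO' ⟨h₁ _ fun z hz => ?_, ?_⟩⟩⟩
  · simpa using (hK z (Or.inl hz)).1.trans_le (min_le_left _ _)
  · exact (hK z (Or.inr hz)).2.trans_le (min_le_right _ _)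
  · simpa [hu] using mem_of_mem_nhds hO₂

theorem graphLimit_pairOp_eq_top (hG : IsSimplyConnected (G : Set ℂ))
    (h0 : (0 : ℂ) ∉ G) (hl₁ : ∀ n, 0 < l₁ n) (hlim₁ : Tendsto l₁ atTop atTop)
    (hlim₂ : Tendsto (fun n => (l₂ n : ℝ) / (l₁ n : ℝ)) atTop atTop) :
    graphLimit (pairOp G l₁ l₂) = ⊤ := by
  set N := graphLimit (pairOp G l₁ l₂) with hN
  have hNc : IsClosed (N : Set (H G × H G × H G)) := isClosed_graphLimit
  have hl₂ := tendsto_of_tendsto_div hl₁ hlim₁ hlim₂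
  have h1 : ∀ f : H G, (f, (0 : H G × H G)) ∈ N := fun f => by
    have hc : IsClosed {f : H G | (f, (0 : H G × H G)) ∈ N} :=
      hNc.preimage (by fun_prop : Continuous fun f : H G => (f, (0 : H G × H G)))
    refine closure_minimal ?_ hc (mem_closure_range_polyH hG h0 f)
    rintro _ ⟨p, rfl⟩
    exact polyH_mem_graphLimit hlim₁ hl₂ (by simp)
  have h2 : ∀ g : H G, ((0 : H G), g, (0 : H G)) ∈ N := fun g => by
    have := eq_top_of_zpowH_mem hG h0
      (N := N.comap (LinearMap.inr ℂ (H G) (H G × H G) ∘ₗ LinearMap.inl ℂ (H G) (H G)))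
      (hNc.preimage (by fun_prop : Continuous fun g : H G => ((0 : H G), g, (0 : H G))))
      fun k hk => zpowH_fst_mem_graphLimit hG h0 hl₁ hlim₁ hlim₂ hk
    exact Submodule.eq_top_iff'.1 this g
  have h3 : ∀ g : H G, ((0 : H G), (0 : H G), g) ∈ N := fun g => by
    have := eq_top_of_zpowH_mem hG h0
      (N := N.comap (LinearMap.inr ℂ (H G) (H G × H G) ∘ₗ LinearMap.inr ℂ (H G) (H G)))
      (hNc.preimage (by fun_prop : Continuous fun g : H G => ((0 : H G), (0 : H G), g)))
      fun k hk => zpowH_snd_mem_graphLimit h0 hl₁ hlim₁ hlim₂ hk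
    exact Submodule.eq_top_iff'.1 this g
  refine Submodule.eq_top_iff'.2 fun ⟨f, g₁, g₂⟩ => ?_
  have := N.add_mem (N.add_mem (h1 f) (h2 g₁)) (h3 g₂)
  simpa using this

end MiddleFactor

end DisjointUniversality

end

theorem theorem1p1 (G : TopologicalSpace.Opens ℂ) (hG : IsSimplyConnected (G : Set ℂ))
    (h0 : (0 : ℂ) ∉ G) (l₁ l₂ : ℕ → ℕ) (hl₁ : ∀ n, 0 < l₁ n) (hl₂ : ∀ n, 0 < l₂ n)
    (hlim₁ : Filter.Tendsto l₁ Filter.atTop Filter.atTop)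
    (hlim₂ : Filter.Tendsto (fun n => (l₂ n : ℝ) / (l₁ n : ℝ)) Filter.atTop Filter.atTop) :
    DisjointUniversality.IsUniversal (fun n =>
        (DisjointUniversality.taylorOp G (l₁ n)).prod (DisjointUniversality.taylorOp G (l₂ n))) ∧
      DisjointUniversality.IsDisjointlyUniversal
        (fun n => DisjointUniversality.taylorOp G (l₁ n))
        (fun n => DisjointUniversality.taylorOp G (l₂ n)) := by
  have h := DisjointUniversality.isUniversal_of_graphLimit_eq_top
    (DisjointUniversality.graphLimit_pairOp_eq_top hG h0 hl₁ hlim₁ hlim₂)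
  exact ⟨h, h⟩
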